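/- Let $k$ be an algebraically closed field and let $\mathcal C$ be a $k$-linear triangulated category with suspension functor $S$, with finite-dimensional $\operatorname{Hom}$-spaces and split idempotents, which is Krull--Schmidt and $2$-Calabi--Yau, i.e. $\mathcal C$ has a Serre functor $\Sigma$ (a $k$-linear autoequivalence with isomorphisms $\operatorname{Hom}_{\mathcal C}(X,Y)\simeq D\operatorname{Hom}_{\mathcal C}(Y,\Sigma X)$ natural in $X$ and $Y$, where $D=\operatorname{Hom}_k(-,k)$) and $\Sigma\simeq S^2$. For an object $X$ of an additive category let $\operatorname{add}X$ be the class of direct factors of finite direct sums of copies of $X$. An object $T$ of $\mathcal C$ is called cluster-tilting if $\operatorname{Hom}_{\mathcal C}(T,ST)=0$ and every $X\in\mathcal C$ with $\operatorname{Hom}_{\mathcal C}(X,ST)=0$ belongs to $\operatorname{add}T$. A finite-dimensional right module $L$ over a finite-dimensional $k$-algebra $A$ is called tilting if $\operatorname{pd}_A L\le 1$, $\operatorname{Ext}^1_A(L,L)=0$, and there is an exact sequence $0\to A\to L^0\to L^1\to 0$ with $L^0,L^1\in\operatorname{add}L$. Let $T$ be a cluster-tilting object of $\mathcal C$, let $\Gamma=\operatorname{End}_{\mathcal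 C}(T)$, let $\operatorname{mod}\Gamma$ be the category of finite-dimensional right $\Gamma$-modules, and let $F=\operatorname{Hom}_{\mathcal C}(T,-)\colon\mathcal C\to\operatorname{mod}\Gamma$. Then $F$ induces an equivalence $\mathcal C/\operatorname{add}ST\simeq\operatorname{mod}\Gamma$, where $\mathcal C/\operatorname{add}ST$ is the quotient of $\mathcal C$ by the morphisms that factor through an object of $\operatorname{add}ST$. Moreover, every tilting $\Gamma$-module $L$ lifts to a cluster-tilting object of $\mathcal C$: there is an object $L^+$ of $\mathcal C$, unique up to isomorphism, such that $FL^+\simeq L$ and $L^+$ has no nonzero direct factor in $\operatorname{add}ST$, and this $L^+$ is cluster-tilting. -/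

import Mathlib

open CategoryTheory CategoryTheory.Limits

universe w v u

namespace ClusterTilting

section Add

variable {D : Type u} [Category.{v} D] [Preadditive D] [HasFiniteBiproducts D]

/-- `add X`: the direct factors of finite direct sums of copies of `X`
(the empty direct sum is allowed). -/
def addClosure (X : D) : ObjectProperty D :=
  fun Y => ∃ n : ℕ, Nonempty (Retract Y (⨁ fun _ : Fin n => X))

/-- Two parallel morphisms are identified in `D / add X` if their difference factors through
an object of `add X`. -/
def addRel (X : D) : HomRel D :=
  fun A B f g => ∃ (Z : D) (a : A ⟶ Z) (b : Z ⟶ B), addClosure X Z ∧ f - g = a ≫ b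

/-- `Y` has no nonzero direct factor lying in `add X`. -/
def HasNoSummandIn (X Y : D) : Prop :=
  ∀ Z : D, Nonempty (Retract Z Y) → addClosure X Z → IsZero Z

variable (D) in
/-- Every object is a finite direct sum of objects with local endomorphism rings. -/
def IsKrullSchmidt : Prop :=
  ∀ X : D, ∃ (n : ℕ) (Y : Fin n → D), (∀ i, IsLocalRing (End (Y i))) ∧ Nonempty (X ≅ ⨁ Y)

end Add

section Modules

variable (k : Type w) [Field k] (A : Type v) [Ring A] [Algebra k A]

/-- The `A`-modules that are finite-dimensional over `k` (acting through `k → A`). -/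
def isFinDim : ObjectProperty (ModuleCat.{v} A) :=
  fun M => letI := ModuleCat.moduleOfAlgebraModule (k := k) M; Module.Finite k M

/-- The category of finite-dimensional left modules over the `k`-algebra `A`. Finite-dimensional
right modules over `Γ` are the objects of `FDMod k Γᵐᵒᵖ`. -/
abbrev FDMod : Type (v + 1) := (isFinDim k A).FullSubcategory

variable {k A}

/-- (Classical) tilting modules: projective dimension at most one, no self-extensions, and a short
exact sequence `0 ⟶ A ⟶ M⁰ ⟶ M¹ ⟶ 0` with `M⁰` and `M¹` in `add M`. -/
structure IsTiltingModule (M : FDMod k A) : Prop where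
  projDim_le_one : HasProjectiveDimensionLE M.obj 1
  ext_one_eq_zero : ∀ e : Abelian.Ext.{v} M.obj M.obj 1, e = 0
  coresolution : ∃ S : ShortComplex (ModuleCat.{v} A), S.ShortExact ∧
    Nonempty (S.X₁ ≅ ModuleCat.of A A) ∧ addClosure M.obj S.X₂ ∧ addClosure M.obj S.X₃

end Modules

section Serre

variable (k : Type w) [Field k] (C : Type u) [Category.{v} C] [Preadditive C] [Linear k C]

/-- A Serre functor: a `k`-linear autoequivalence `Σ` together with isomorphisms
`Hom(X, Y) ≃ D Hom(Y, Σ X)` natural in `X` and `Y`, where `D` is the `k`-dual. -/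
structure SerreFunctor where
  functor : C ⥤ C
  isEquivalence : functor.IsEquivalence
  additive : functor.Additive
  linear : functor.Linear k
  duality (X Y : C) : (X ⟶ Y) ≃ₗ[k] Module.Dual k (Y ⟶ functor.obj X)
  naturality {X X' Y Y' : C} (a : X' ⟶ X) (f : X ⟶ Y) (b : Y ⟶ Y')
    (g : Y' ⟶ functor.obj X') :
    duality X' Y' (a ≫ f ≫ b) g = duality X Y f (b ≫ g ≫ functor.map a)

/-- Calabi-Yau of dimension 2: there is a Serre functor, and it is isomorphic to the square of
the suspension. Only an isomorphism of functors is asked for (no compatibility with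
triangulated structures). -/
def IsTwoCalabiYau [HasShift C ℤ] : Prop :=
  ∃ S : SerreFunctor k C, Nonempty (shiftFunctor C (2 : ℤ) ≅ S.functor)

end Serre

section ClusterTilting

variable {C : Type u} [Category.{v} C] [Preadditive C] [HasFiniteBiproducts C] [HasShift C ℤ]

/-- Cluster-tilting objects: `Ext¹(T, T) = Hom(T, ST) = 0`, and every `X` with
`Hom(X, ST) = 0` belongs to `add T`. -/
structure IsClusterTilting (T : C) : Prop where
  rigid : ∀ f : T ⟶ T⟦(1 : ℤ)⟧, f = 0
  maximal : ∀ X : C, (∀ f : X ⟶ T⟦(1 : ℤ)⟧, f = 0) → addClosure T X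

end ClusterTilting

section HomFunctor

variable (k : Type w) [Field k] {C : Type u} [Category.{v} C] [Preadditive C] [Linear k C]
  [∀ X Y : C, Module.Finite k (X ⟶ Y)]

/-- `Hom(T, X)` is a finite-dimensional right `End T`-module. -/
lemma isFinDim_hom (T X : C) :
    isFinDim k (End T)ᵐᵒᵖ ((preadditiveCoyonedaObj T).obj X) := by
  let := ModuleCat.moduleOfAlgebraModule (k := k) ((preadditiveCoyonedaObj T).obj X)
  let e : (T ⟶ X) →ₗ[k] ((preadditiveCoyonedaObj T).obj X) :=
    { toFun := fun f => f
      map_add' := fun _ _ => rfl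
      map_smul' := fun c f => by
        change c • f = (c • 𝟙 T) ≫ f
        simp }
  exact Module.Finite.of_surjective e (fun f => ⟨f, rfl⟩)

/-- The functor `F = Hom(T, -) : C ⥤ mod Γ`, where `Γ = End T` and `mod Γ` is the category of
finite-dimensional right `Γ`-modules. -/
def homFunctor (T : C) : C ⥤ FDMod k (End T)ᵐᵒᵖ :=
  (isFinDim k (End T)ᵐᵒᵖ).lift (preadditiveCoyonedaObj T) (isFinDim_hom k T)

end HomFunctor

end ClusterTilting

/-! Write `F = Hom(T, -)`. Every `X` sits in a triangle `T₁ ⟶ T₀ ⟶ X ⟶ ST₁` with both `Tᵢ` in `add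
T` (`IsClusterTilting.exists_triangle`). As `Hom(T, ST₁) = 0`, `F` turns it into a projective
presentation of `FX`. Since `F` is fully faithful on `add T`, morphisms between presentations lift
to `C`, which gives fullness; a morphism killed by `F` vanishes on `T₀`, so it factors through
`ST₁`; and the cone of a lifted presentation realises any given module.

By Fitting's lemma, an endomorphism of an object `P` without summands in `add ST` is invertible as
soon as `F` sends it to the identity. Hence isomorphisms and retracts lift from modules to such
objects, and the lift of `L` is unique.

Let `P` be the lift of a tilting module. Rigidity (`rigid_lift`): projective dimension at most one
makes `FT₁ ⟶ FT₀` mono, and `Ext¹(L, L) = 0` then extends every `T₁ ⟶ P` to `T₀`. So `Hom(P, SP) ⟶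
Hom(T₀, SP)` is injective, and Serre duality together with rigidity of `T₀` forces `Hom(P, SP) = 0`.
Maximality (`of_triangle`): the coresolution of `Γ` lifts to a triangle `T ⟶ P₀ ⟶ Y ⟶ ST` with `P₀`,
`Y` in `add P`, through which vanishing statements about `P` control maps out of `T`. -/

namespace ClusterTilting

open Pretriangulated

/-! ### Closure properties of `add X`. -/

section Add

variable {D : Type u} [Category.{v} D] [Preadditive D] [HasFiniteBiproducts D]

/-- An object whose identity is a finite sum of endomorphisms factoring through `X` is in
`add X`. -/
lemma addClosure_of_sum {X Y : D} {ι : Type} [Fintype ι] (a : ι → (Y ⟶ X)) (b : ι → (X ⟶ Y))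
    (h : ∑ j, a j ≫ b j = 𝟙 Y) : addClosure X Y := by
  let e := Fintype.equivFin ι
  refine ⟨Fintype.card ι, ⟨⟨biproduct.lift fun j => a (e.symm j),
    biproduct.desc fun j => b (e.symm j), ?_⟩⟩⟩
  rw [biproduct.lift_desc, ← h]
  exact e.symm.sum_comp fun j => a j ≫ b j

/-- Writing the identity as a sum through `X` makes membership in `add X` stable under additive
functors and reduces vanishing on `Y` to vanishing on `X`. -/
lemma addClosure.exists_sum {X Y : D} (h : addClosure X Y) :
    ∃ (n : ℕ) (a : Fin n → (Y ⟶ X)) (b : Fin n → (X ⟶ Y)), ∑ j, a j ≫ b j = 𝟙 Y := by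
  obtain ⟨n, ⟨ρ⟩⟩ := h
  refine ⟨n, fun j => ρ.i ≫ biproduct.π _ j, fun j => biproduct.ι (fun _ : Fin n => X) j ≫ ρ.r, ?_⟩
  calc _ = ρ.i ≫ (∑ j, biproduct.π (fun _ : Fin n => X) j ≫
          biproduct.ι (fun _ : Fin n => X) j) ≫ ρ.r := by
        simp only [Preadditive.comp_sum, Preadditive.sum_comp, Category.assoc]
    _ = 𝟙 Y := by rw [biproduct.total, Category.id_comp, ρ.retract]

lemma addClosure_biproduct (X : D) (n : ℕ) : addClosure X (⨁ fun _ : Fin n => X) :=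
  ⟨n, ⟨⟨𝟙 _, 𝟙 _, Category.id_comp _⟩⟩⟩

lemma addClosure_self (X : D) : addClosure X X :=
  addClosure_of_sum (ι := Unit) (fun _ => 𝟙 X) (fun _ => 𝟙 X) (by simp)

lemma addClosure.of_retract {X Y Z : D} (h : addClosure X Y) (ρ : Retract Z Y) :
    addClosure X Z := by
  obtain ⟨n, ⟨σ⟩⟩ := h
  exact ⟨n, ⟨⟨ρ.i ≫ σ.i, σ.r ≫ ρ.r, by
    rw [Category.assoc, reassoc_of% σ.retract, ρ.retract]⟩⟩⟩

/-- The two composites need not be idempotent, so no direct sum decomposition of `W` has to be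
produced. -/
lemma addClosure.of_id_eq_add {X Y Z W : D} (hY : addClosure X Y) (hZ : addClosure X Z)
    (a : W ⟶ Y) (b : Y ⟶ W) (c : W ⟶ Z) (d : Z ⟶ W) (h : a ≫ b + c ≫ d = 𝟙 W) :
    addClosure X W := by
  obtain ⟨n, y, y', hy⟩ := hY.exists_sum
  obtain ⟨m, z, z', hz⟩ := hZ.exists_sum
  refine addClosure_of_sum (ι := Fin n ⊕ Fin m) (Sum.elim (fun j => a ≫ y j) fun j => c ≫ z j)
    (Sum.elim (fun j => y' j ≫ b) fun j => z' j ≫ d) ?_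
  rw [Fintype.sum_sum_type]
  have h₁ : ∑ j, (a ≫ y j) ≫ y' j ≫ b = a ≫ b := by
    conv_rhs => rw [← Category.id_comp b, ← hy]
    simp [Preadditive.comp_sum, Preadditive.sum_comp]
  have h₂ : ∑ j, (c ≫ z j) ≫ z' j ≫ d = c ≫ d := by
    conv_rhs => rw [← Category.id_comp d, ← hz]
    simp [Preadditive.comp_sum, Preadditive.sum_comp]
  exact (congrArg₂ (· + ·) h₁ h₂).trans h

lemma addClosure.of_iso_left {X X' Y : D} (h : addClosure X Y) (e : X ≅ X') : addClosure X' Y := by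
  obtain ⟨n, a, b, hab⟩ := h.exists_sum
  exact addClosure_of_sum (fun j => a j ≫ e.hom) (fun j => e.inv ≫ b j) (by simpa using hab)

lemma addClosure.map {E : Type*} [Category* E] [Preadditive E] [HasFiniteBiproducts E]
    {X Y : D} (h : addClosure X Y) (F : D ⥤ E) [F.Additive] :
    addClosure (F.obj X) (F.obj Y) := by
  obtain ⟨n, a, b, hab⟩ := h.exists_sum
  refine addClosure_of_sum (fun j => F.map (a j)) (fun j => F.map (b j)) ?_
  rw [← F.map_id, ← hab, F.map_sum]
  simp

lemma addClosure.hom_eq_zero {X Y Z : D} (h : addClosure X Y) (hX : ∀ f : X ⟶ Z, f = 0)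
    (f : Y ⟶ Z) : f = 0 := by
  obtain ⟨n, a, b, hab⟩ := h.exists_sum
  rw [← Category.id_comp f, ← hab, Preadditive.sum_comp]
  exact Finset.sum_eq_zero fun j _ => by rw [Category.assoc, hX (b j ≫ f), comp_zero]

lemma addClosure.comp_eq_zero {X Y Z W : D} (h : addClosure X Y) (g : Z ⟶ W)
    (hX : ∀ f : X ⟶ Z, f ≫ g = 0) (f : Y ⟶ Z) : f ≫ g = 0 := by
  obtain ⟨n, a, b, hab⟩ := h.exists_sum
  rw [← Category.id_comp f, ← hab, Preadditive.sum_comp, Preadditive.sum_comp]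
  exact Finset.sum_eq_zero fun j _ => by
    rw [Category.assoc, Category.assoc, ← Category.assoc (b j), hX (b j ≫ f), comp_zero]

lemma addClosure.hom_to_eq_zero {X Y Z : D} (h : addClosure X Y) (hX : ∀ f : Z ⟶ X, f = 0)
    (f : Z ⟶ Y) : f = 0 := by
  obtain ⟨n, a, b, hab⟩ := h.exists_sum
  rw [← Category.comp_id f, ← hab, Preadditive.comp_sum]
  exact Finset.sum_eq_zero fun j _ => by rw [← Category.assoc, hX (f ≫ a j), zero_comp]

end Add

/-! ### `Hom(T, -)` on `add T`: projectivity and full faithfulness. -/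

section CoyonedaModule

variable {C : Type u} [Category.{v} C] [Preadditive C] (T : C)

lemma coyoneda_map_eq_iff {X Y : C} (f g : X ⟶ Y) :
    (preadditiveCoyonedaObj T).map f = (preadditiveCoyonedaObj T).map g ↔
      ∀ x : T ⟶ X, x ≫ f = x ≫ g :=
  ⟨fun h x => congrArg (fun φ => φ.hom x) h, fun h => by ext x; exact h x⟩

lemma coyoneda_map_eq_zero_iff {X Y : C} (f : X ⟶ Y) :
    (preadditiveCoyonedaObj T).map f = 0 ↔ ∀ x : T ⟶ X, x ≫ f = 0 := by
  rw [← (preadditiveCoyonedaObj T).map_zero, coyoneda_map_eq_iff]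
  simp

variable {T}

/-- The linear map `Hom(T, X) ⟶ M` attached to morphisms `X ⟶ T` and elements of `M`. -/
def coyonedaDesc {X : C} {n : ℕ} (a : Fin n → (X ⟶ T)) {M : ModuleCat.{v} (End T)ᵐᵒᵖ}
    (m : Fin n → M) : (preadditiveCoyonedaObj T).obj X ⟶ M :=
  ModuleCat.ofHom
    { toFun := fun x : T ⟶ X => ∑ j, (MulOpposite.op (End.of (x ≫ a j))) • m j
      map_add' := fun x y => by
        rw [← Finset.sum_add_distrib]
        refine Finset.sum_congr rfl fun j _ => ?_
        rw [← add_smul, ← MulOpposite.op_add]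
        congr 2
        exact Preadditive.add_comp _ _ _ _ _ _
      map_smul' := fun r x => by
        rw [RingHom.id_apply, Finset.smul_sum]
        refine Finset.sum_congr rfl fun j _ => ?_
        rw [smul_smul]
        congr 1
        exact congrArg MulOpposite.op (Category.assoc r.unop x (a j)) }

lemma coyoneda_hom_ext {X : C} {M : ModuleCat.{v} (End T)ᵐᵒᵖ}
    {φ ψ : (preadditiveCoyonedaObj T).obj X ⟶ M}
    (h : ∀ x : T ⟶ X, φ.hom x = ψ.hom x) : φ = ψ :=
  ModuleCat.hom_ext (LinearMap.ext h)

lemma coyonedaDesc_comp {X : C} {n : ℕ} (a : Fin n → (X ⟶ T)) {M N : ModuleCat.{v} (End T)ᵐᵒᵖ}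
    (m : Fin n → M) (φ : M ⟶ N) :
    coyonedaDesc a m ≫ φ = coyonedaDesc a fun j => φ.hom (m j) := by
  refine coyoneda_hom_ext fun x => ?_
  change φ.hom (∑ j, (MulOpposite.op (End.of (x ≫ a j))) • m j) =
    ∑ j, (MulOpposite.op (End.of (x ≫ a j))) • φ.hom (m j)
  simp [map_sum]

/-- The pairs `(a j, b j)` act as a dual basis of the projective module `Hom(T, X)`, so a linear map
is determined by its values on the `b j`. -/
lemma hom_eq_coyonedaDesc {X : C} {n : ℕ} {a : Fin n → (X ⟶ T)} {b : Fin n → (T ⟶ X)}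
    (hab : ∑ j, a j ≫ b j = 𝟙 X) {M : ModuleCat.{v} (End T)ᵐᵒᵖ}
    (φ : (preadditiveCoyonedaObj T).obj X ⟶ M) : φ = coyonedaDesc a fun j => φ.hom (b j) := by
  refine coyoneda_hom_ext fun x => ?_
  let B : Fin n → (preadditiveCoyonedaObj T).obj X := b
  have hx : x = ∑ j, (MulOpposite.op (End.of (x ≫ a j))) • B j := by
    change x = ∑ j, (x ≫ a j) ≫ b j
    conv_lhs => rw [← Category.comp_id x, ← hab, Preadditive.comp_sum]
    simp
  conv_lhs => rw [hx]
  change φ.hom _ = ∑ j, (MulOpposite.op (End.of (x ≫ a j))) • φ.hom (B j)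
  rw [map_sum]
  simp

variable [HasFiniteBiproducts C]

lemma addClosure.projective_coyoneda {X : C} (h : addClosure T X) :
    Projective ((preadditiveCoyonedaObj T).obj X) := by
  obtain ⟨n, a, b, hab⟩ := h.exists_sum
  refine ⟨fun {M N} f e _ => ?_⟩
  choose m hm using fun j => (ModuleCat.epi_iff_surjective e).1 inferInstance (f.hom (b j))
  exact ⟨coyonedaDesc a m, by
    rw [coyonedaDesc_comp, hom_eq_coyonedaDesc hab f]
    congr 1
    exact funext hm⟩

/-- Linear maps `Hom(T, X) ⟶ Hom(T, Y)` with `X` in `add T` come from morphisms `X ⟶ Y`. -/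
lemma addClosure.exists_coyoneda_map_eq {X Y : C} (h : addClosure T X)
    (φ : (preadditiveCoyonedaObj T).obj X ⟶ (preadditiveCoyonedaObj T).obj Y) :
    ∃ f : X ⟶ Y, (preadditiveCoyonedaObj T).map f = φ := by
  obtain ⟨n, a, b, hab⟩ := h.exists_sum
  let y : Fin n → (T ⟶ Y) := fun j => φ.hom (b j)
  refine ⟨∑ j, a j ≫ y j, ?_⟩
  rw [hom_eq_coyonedaDesc hab φ]
  refine coyoneda_hom_ext fun x => ?_
  change x ≫ (∑ j, a j ≫ y j) = ∑ j, (x ≫ a j) ≫ y j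
  simp [Preadditive.comp_sum]

lemma addClosure.eq_zero_of_coyoneda_map {X Y : C} (h : addClosure T X) {f : X ⟶ Y}
    (hf : (preadditiveCoyonedaObj T).map f = 0) : f = 0 := by
  rw [← Category.id_comp f]
  exact h.comp_eq_zero f ((coyoneda_map_eq_zero_iff T f).1 hf) _

lemma exists_retract_coyoneda_biproduct {P : C} {M : ModuleCat.{v} (End T)ᵐᵒᵖ}
    (h : addClosure ((preadditiveCoyonedaObj T).obj P) M) :
    ∃ n : ℕ, Nonempty (Retract M ((preadditiveCoyonedaObj T).obj (⨁ fun _ : Fin n => P))) := by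
  obtain ⟨n, a, b, hab⟩ := h.exists_sum
  let F := preadditiveCoyonedaObj T
  refine ⟨n, ⟨⟨∑ j, a j ≫ F.map (biproduct.ι (fun _ : Fin n => P) j),
    ∑ j, F.map (biproduct.π (fun _ : Fin n => P) j) ≫ b j, ?_⟩⟩⟩
  rw [← hab, Preadditive.sum_comp]
  refine Finset.sum_congr rfl fun j _ => ?_
  rw [Preadditive.comp_sum, Finset.sum_eq_single j]
  · rw [Category.assoc, ← Category.assoc (F.map _), ← F.map_comp, biproduct.ι_π_self, F.map_id,
      Category.id_comp]
  · intro i _ hij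
    rw [Category.assoc, ← Category.assoc (F.map _), ← F.map_comp, biproduct.ι_π_ne _ hij.symm,
      F.map_zero, zero_comp, comp_zero]
  · simp

variable (T) in
/-- The regular right module is `Hom(T, T)`. -/
def coyonedaSelfIso :
    (preadditiveCoyonedaObj T).obj T ≅ ModuleCat.of (End T)ᵐᵒᵖ (End T)ᵐᵒᵖ :=
  LinearEquiv.toModuleIso
    { toFun := fun f : T ⟶ T => MulOpposite.op (End.of f)
      invFun := fun f => f.unop
      map_add' := fun _ _ => rfl
      map_smul' := fun _ _ => rfl
      left_inv := fun _ => rfl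
      right_inv := fun _ => rfl }

end CoyonedaModule

/-! ### Consequences of Serre duality. -/

section Duality

variable {k : Type w} [Field k] {C : Type u} [Category.{v} C] [Preadditive C] [Linear k C]
  [HasShift C ℤ] [∀ n : ℤ, (shiftFunctor C n).Additive]

/-- `Hom(SX, FY) ≃ Hom(SX, S²Y) ≃ Hom(X, SY)`, as `S` is fully faithful. -/
lemma hom_shift_two_eq_zero {F : C ⥤ C}
    (α : shiftFunctor C (2 : ℤ) ≅ F) {X Y : C}
    (h : ∀ f : X ⟶ Y⟦(1 : ℤ)⟧, f = 0) (g : X⟦(1 : ℤ)⟧ ⟶ F.obj Y) : g = 0 := by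
  let e : F.obj Y ≅ (Y⟦(1 : ℤ)⟧)⟦(1 : ℤ)⟧ :=
    (α.app Y).symm ≪≫ (shiftFunctorAdd' C (1 : ℤ) 1 2 (by norm_num)).app Y
  obtain ⟨f, hf⟩ := (shiftFunctor C (1 : ℤ)).map_surjective (g ≫ e.hom)
  rw [h f, Functor.map_zero] at hf
  rw [← cancel_mono e.hom, ← hf, zero_comp]

/-- In a 2-Calabi-Yau category, the vanishing of `Ext¹` is symmetric. -/
lemma IsTwoCalabiYau.hom_shift_symm (hCY : IsTwoCalabiYau k C) {X Y : C}
    (h : ∀ f : X ⟶ Y⟦(1 : ℤ)⟧, f = 0) (f : Y ⟶ X⟦(1 : ℤ)⟧) : f = 0 := by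
  obtain ⟨Φ, ⟨α⟩⟩ := hCY
  apply (Φ.duality _ _).injective
  ext g
  rw [hom_shift_two_eq_zero α h g]
  simp

/-- If restriction along `p : X ⟶ Y` is injective on `Hom(Y, SY)` and `X` is rigid, then `Y` is
rigid. -/
lemma IsTwoCalabiYau.hom_shift_eq_zero_of_precomp (hCY : IsTwoCalabiYau k C) {X Y : C}
    (p : X ⟶ Y) (hX : ∀ f : X ⟶ X⟦(1 : ℤ)⟧, f = 0)
    (hp : ∀ f : Y ⟶ Y⟦(1 : ℤ)⟧, p ≫ f = 0 → f = 0) (f : Y ⟶ Y⟦(1 : ℤ)⟧) : f = 0 := by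
  obtain ⟨Φ, ⟨α⟩⟩ := hCY
  -- The dual of injectivity of `p ≫ -`: a functional vanishing on the image of `- ≫ Σp` is
  -- represented by some `u` with `p ≫ u = 0`, hence is zero.
  have hs : ∀ g : Y⟦(1 : ℤ)⟧ ⟶ Φ.functor.obj Y, ∃ h : Y⟦(1 : ℤ)⟧ ⟶ Φ.functor.obj X,
      h ≫ Φ.functor.map p = g := by
    by_contra! hg
    obtain ⟨g, hg⟩ := hg
    let R := LinearMap.range (Linear.rightComp k (Y⟦(1 : ℤ)⟧) (Φ.functor.map p))
    have hR : R < ⊤ := lt_top_iff_ne_top.2 fun hR => by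
      obtain ⟨h, hh⟩ : g ∈ R := hR ▸ Submodule.mem_top
      exact hg h hh
    obtain ⟨φ, hφ, hφR⟩ := R.exists_le_ker_of_lt_top hR
    obtain ⟨u, rfl⟩ := (Φ.duality Y (Y⟦(1 : ℤ)⟧)).surjective φ
    refine hφ ?_
    rw [hp u, map_zero]
    apply (Φ.duality _ _).injective
    ext h
    have := Φ.naturality p u (𝟙 _) h
    rw [Category.comp_id, Category.id_comp] at this
    rw [this, map_zero]
    exact hφR ⟨h, rfl⟩
  let e : Φ.functor.obj Y ≅ (Y⟦(1 : ℤ)⟧)⟦(1 : ℤ)⟧ :=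
    (α.app Y).symm ≪≫ (shiftFunctorAdd' C (1 : ℤ) 1 2 (by norm_num)).app Y
  obtain ⟨h, hh⟩ := hs (f⟦1⟧' ≫ e.inv)
  refine hp f ((shiftFunctor C (1 : ℤ)).map_injective ?_)
  rw [Functor.map_zero, ← cancel_mono e.inv, zero_comp, Functor.map_comp, Category.assoc, ← hh,
    ← Category.assoc, hom_shift_two_eq_zero α hX (p⟦1⟧' ≫ h), zero_comp]

end Duality

/-! ### Fitting's lemma, splitting off summands, and approximations. -/

/-- Fitting's lemma for an element of a finite-dimensional algebra. -/
lemma exists_idempotent_of_finite (k : Type w) {A : Type*} [Field k] [Ring A] [Algebra k A]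
    [Module.Finite k A] (y : A) :
    ∃ (n : ℕ) (e c : A), e * e = e ∧ e = y * c ∧ y ^ n * e = y ^ n := by
  have hy : IsIntegral k y := Algebra.IsIntegral.isIntegral y
  obtain ⟨q, hq, hq'⟩ := Polynomial.exists_eq_pow_rootMultiplicity_mul_and_not_dvd
    (minpoly k y) (minpoly.ne_zero hy) 0
  set n := (minpoly k y).rootMultiplicity 0
  rw [map_zero, sub_zero] at hq hq'
  -- The exponent `n + 1` rather than `n` keeps `e` a multiple of `y` even when `n = 0`.
  obtain ⟨u, v, huv⟩ : IsCoprime ((Polynomial.X : Polynomial k) ^ (n + 1)) q :=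
    ((Polynomial.irreducible_X.coprime_iff_not_dvd).2 hq').pow_left
  have hyq : y ^ (n + 1) * Polynomial.aeval y q = 0 := by
    have := congrArg (Polynomial.aeval y) hq
    rw [minpoly.aeval, map_mul, map_pow, Polynomial.aeval_X] at this
    rw [pow_succ', mul_assoc, ← this, mul_zero]
  have huv' : y ^ (n + 1) * Polynomial.aeval y u =
      1 - Polynomial.aeval y q * Polynomial.aeval y v := by
    have := congrArg (Polynomial.aeval y) huv
    rw [mul_comm u, mul_comm v] at this
    simp only [map_add, map_mul, map_pow, Polynomial.aeval_X, map_one] at this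
    exact eq_sub_of_add_eq this
  have hcomm : y ^ (n + 1) * Polynomial.aeval y u = Polynomial.aeval y u * y ^ (n + 1) := by
    have := congrArg (Polynomial.aeval y) (mul_comm (Polynomial.X ^ (n + 1)) u)
    simpa only [map_mul, map_pow, Polynomial.aeval_X] using this
  have hn : y ^ (n + 1) * (y ^ (n + 1) * Polynomial.aeval y u) = y ^ (n + 1) := by
    rw [huv', mul_sub, mul_one, ← mul_assoc, hyq, zero_mul, sub_zero]
  refine ⟨n + 1, y ^ (n + 1) * Polynomial.aeval y u, y ^ n * Polynomial.aeval y u, ?_, ?_, hn⟩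
  · conv_lhs => rw [hcomm, mul_assoc, ← hcomm, hn]
    exact hcomm.symm
  · rw [pow_succ', mul_assoc]

section Retracts

variable {C : Type u} [Category.{v} C] [Preadditive C] [HasFiniteBiproducts C]

/-- If `P` has no summand in `add X`, the endomorphisms factoring through `add X` are
radical. -/
lemma HasNoSummandIn.isIso_of_factor (k : Type w) [Field k] [Linear k C]
    [∀ X Y : C, Module.Finite k (X ⟶ Y)] [IsIdempotentComplete C]
    {X P Z : C} (hP : HasNoSummandIn X P)
    (hZ : addClosure X Z) (x : P ⟶ P) (a : P ⟶ Z) (b : Z ⟶ P) (hx : 𝟙 P - x = a ≫ b) :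
    IsIso x := by
  let y : End P := a ≫ b
  have : Module.Finite k (End P) := inferInstanceAs (Module.Finite k (P ⟶ P))
  obtain ⟨n, e, c, he, hec, hn⟩ := exists_idempotent_of_finite k y
  obtain ⟨E, i, r, hir, hri⟩ := IsIdempotentComplete.idempotents_split P e he
  have hec' : e = c ≫ a ≫ b := hec
  -- The Fitting idempotent of `y` factors through `Z`, so its image is a summand of `P` in `add X`.
  -- Its vanishing makes `y` nilpotent and `x = 1 - y` invertible.
  have hE : IsZero E := by
    refine hP E ⟨⟨i, r, hir⟩⟩ (hZ.of_retract ⟨i ≫ c ≫ a, b ≫ r, ?_⟩)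
    calc (i ≫ c ≫ a) ≫ b ≫ r = i ≫ (c ≫ a ≫ b) ≫ r := by simp
      _ = 𝟙 E := by rw [← hec', ← hri, Category.assoc, reassoc_of% hir, hir]
  have he0 : e = 0 := by
    rw [← hri, hE.eq_of_tgt r 0, zero_comp]
  rw [he0, mul_zero] at hn
  have hu : IsUnit (1 - y) := IsNilpotent.isUnit_one_sub ⟨n, hn.symm⟩
  have hxy : (1 - y : End P) = x := by
    change 𝟙 P - a ≫ b = x
    rw [← hx, sub_sub_cancel]
  rw [hxy] at hu
  exact (isUnit_iff_isIso x).1 hu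

/-- Every object has a retract without summands in `add X`, with the same morphisms from any `T`
such that `Hom(T, X) = 0`. -/
lemma exists_hasNoSummandIn_retract (k : Type w) [Field k] [Linear k C]
    [∀ X Y : C, Module.Finite k (X ⟶ Y)] [IsIdempotentComplete C]
    {T X : C} (h : ∀ f : T ⟶ X, f = 0) (Y : C) :
    ∃ (Y' : C) (ρ : Retract Y' Y), HasNoSummandIn X Y' ∧ ∀ x : T ⟶ Y, x ≫ ρ.r ≫ ρ.i = x := by
  induction hd : Module.finrank k (Y ⟶ Y) using Nat.strong_induction_on generalizing Y with
  | _ d ih =>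
  by_cases hY : HasNoSummandIn X Y
  · exact ⟨Y, Retract.refl Y, hY, fun x => by simp⟩
  · obtain ⟨Z, σ, hZ, hZ0⟩ : ∃ (Z : C) (_ : Retract Z Y), addClosure X Z ∧ ¬ IsZero Z := by
      unfold HasNoSummandIn at hY
      push Not at hY
      obtain ⟨Z, ⟨σ⟩, hZ⟩ := hY
      exact ⟨Z, σ, hZ⟩
    obtain ⟨Y₁, i, e, hie, hei⟩ := IsIdempotentComplete.idempotents_split Y (𝟙 Y - σ.r ≫ σ.i)
      (by simp [Preadditive.sub_comp, Preadditive.comp_sub, reassoc_of% σ.retract])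
    have hσe : σ.i ≫ e = 0 := by
      calc σ.i ≫ e = σ.i ≫ (e ≫ i) ≫ e := by simp [hie]
        _ = 0 := by simp [hei, Preadditive.sub_comp, Preadditive.comp_sub,
          reassoc_of% σ.retract]
    let φ : (Y₁ ⟶ Y₁) →ₗ[k] (Y ⟶ Y) := Linear.rightComp k Y i ∘ₗ Linear.leftComp k Y₁ e
    have hφ : ∀ f, φ f = e ≫ f ≫ i := fun f => by simp [φ]
    have hinj : Function.Injective φ := fun f g hfg => by
      rw [hφ, hφ] at hfg
      have := congrArg (fun z => i ≫ z ≫ e) hfg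
      simpa [hie, reassoc_of% hie] using this
    -- The embedding `f ↦ e ≫ f ≫ i` misses `𝟙 Y`, since `σ.i ≫ e = 0` while `Z` is nonzero.
    have hlt : Module.finrank k (Y₁ ⟶ Y₁) < d := by
      rw [← LinearMap.finrank_range_of_inj hinj, ← hd]
      refine Submodule.finrank_lt (lt_top_iff_ne_top.2 fun htop => hZ0 ?_).ne
      obtain ⟨f, hf⟩ : 𝟙 Y ∈ LinearMap.range φ := htop ▸ Submodule.mem_top
      rw [IsZero.iff_id_eq_zero, ← σ.retract, ← Category.comp_id σ.i, ← hf, hφ,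
        reassoc_of% hσe, zero_comp, zero_comp]
    obtain ⟨Y', ρ, hY', hρ⟩ := ih _ hlt Y₁ rfl
    refine ⟨Y', ⟨ρ.i ≫ i, e ≫ ρ.r, by simp [reassoc_of% hie, ρ.retract]⟩, hY', fun x => ?_⟩
    have h₁ := hρ (x ≫ e)
    calc x ≫ (e ≫ ρ.r) ≫ ρ.i ≫ i = ((x ≫ e) ≫ ρ.r ≫ ρ.i) ≫ i := by simp
      _ = x := by
        rw [h₁, Category.assoc, hei, Preadditive.comp_sub, Category.comp_id, ← Category.assoc,
          hZ.hom_to_eq_zero h (x ≫ σ.r), zero_comp, sub_zero]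

/-- Right `add T`-approximations exist. -/
lemma exists_approximation (k : Type w) [Field k] [Linear k C]
    [∀ X Y : C, Module.Finite k (X ⟶ Y)] (T X : C) :
    ∃ (n : ℕ) (p : (⨁ fun _ : Fin n => T) ⟶ X), ∀ g : T ⟶ X, ∃ g', g' ≫ p = g := by
  obtain ⟨n, s, hs⟩ := Module.Finite.exists_fin (R := k) (M := (T ⟶ X))
  refine ⟨n, biproduct.desc s, fun g => ?_⟩
  obtain ⟨c, hc⟩ := (Submodule.mem_span_range_iff_exists_fun k).1 (hs ▸ Submodule.mem_top (x := g))
  exact ⟨∑ j, c j • biproduct.ι (fun _ : Fin n => T) j, by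
    simp [Preadditive.sum_comp, ← hc]⟩

end Retracts

/-! ### Cokernels, extensions and finite-dimensionality. -/

section Modules

/-- Comparison of two cokernels. -/
lemma nonempty_iso_of_exact {A : Type*} [Category* A] [Abelian A] {S R : ShortComplex A}
    (h : S.Exact) (h' : R.Exact) [Epi S.g] [Epi R.g] (e₁ : S.X₁ ≅ R.X₁) (e₂ : S.X₂ ≅ R.X₂)
    (comm : e₁.hom ≫ R.f = S.f ≫ e₂.hom) : Nonempty (S.X₃ ≅ R.X₃) := by
  have comm' : e₁.inv ≫ S.f = R.f ≫ e₂.inv := by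
    rw [Iso.inv_comp_eq, ← Category.assoc, comm]; simp
  refine ⟨⟨h.desc (e₂.hom ≫ R.g) (by rw [← Category.assoc, ← comm]; simp),
    h'.desc (e₂.inv ≫ S.g) (by rw [← Category.assoc, ← comm']; simp), ?_, ?_⟩⟩
  · rw [← cancel_epi S.g]; simp
  · rw [← cancel_epi R.g]; simp

/-- Vanishing of `Ext¹(M, M)` in terms of a presentation of `M`. -/
lemma exists_extension_of_ext_eq_zero {A : Type*} [Category* A] [Abelian A] [HasExt.{v} A]
    {S : ShortComplex A} (hS : S.ShortExact) {M : A}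
    (h : ∀ e : Abelian.Ext.{v} S.X₃ M 1, e = 0) (f : S.X₁ ⟶ M) : ∃ g : S.X₂ ⟶ M, S.f ≫ g = f := by
  obtain ⟨x, hx⟩ := Abelian.Ext.contravariant_sequence_exact₁ hS M (Abelian.Ext.mk₀ f)
    (add_zero 1) (h _)
  obtain ⟨g, rfl⟩ := (Abelian.Ext.mk₀_bijective _ _).2 x
  rw [Abelian.Ext.mk₀_comp_mk₀] at hx
  exact ⟨g, (Abelian.Ext.mk₀_bijective _ _).1 hx⟩

variable {k : Type w} [Field k] {A : Type v} [Ring A] [Algebra k A]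

/-- The tilting coresolution lives among all modules; its middle term must be finite-dimensional
before it can be lifted to `C`. -/
lemma isFinDim_of_retract {M N : ModuleCat.{v} A} (hN : isFinDim k A N) (ρ : Retract M N) :
    isFinDim k A M := by
  let := ModuleCat.moduleOfAlgebraModule (k := k) M
  let := ModuleCat.moduleOfAlgebraModule (k := k) N
  have := ModuleCat.isScalarTower_of_algebra_moduleCat (k := k) M
  have := ModuleCat.isScalarTower_of_algebra_moduleCat (k := k) N
  have : Module.Finite k N := hN
  refine Module.Finite.of_surjective (ρ.r.hom.restrictScalars k) fun x => ⟨ρ.i.hom x, ?_⟩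
  exact congrArg (fun φ => φ.hom x) ρ.retract

end Modules

/-! ### Presentations by `add T`, and a criterion for being cluster-tilting. -/

section Triangulated

variable {C : Type u} [Category.{v} C] [Preadditive C] [HasZeroObject C] [HasShift C ℤ]
  [∀ n : ℤ, (shiftFunctor C n).Additive] [Pretriangulated C]

/-- `Hom(T, -)` turns the first two maps of a distinguished triangle into an exact sequence. -/
lemma coyoneda_exact (T : C) {X Y Z : C} {f : X ⟶ Y} {g : Y ⟶ Z} {h : Z ⟶ X⟦(1 : ℤ)⟧}
    (hD : Triangle.mk f g h ∈ distTriang C) :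
    (ShortComplex.mk ((preadditiveCoyonedaObj T).map f) ((preadditiveCoyonedaObj T).map g)
      (by rw [← Functor.map_comp, show f ≫ g = 0 from comp_distTriang_mor_zero₁₂ _ hD,
        Functor.map_zero])).Exact := by
  rw [ShortComplex.moduleCat_exact_iff]
  intro x hx
  obtain ⟨y, hy⟩ := Triangle.coyoneda_exact₂ _ hD (X := T) x hx
  exact ⟨y, hy.symm⟩

lemma epi_coyoneda_map {T : C} {X Y Z : C} {f : X ⟶ Y} {g : Y ⟶ Z} {h : Z ⟶ X⟦(1 : ℤ)⟧}
    (hD : Triangle.mk f g h ∈ distTriang C) (hX : ∀ u : T ⟶ X⟦(1 : ℤ)⟧, u = 0) :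
    Epi ((preadditiveCoyonedaObj T).map g) := by
  rw [ModuleCat.epi_iff_surjective]
  intro x
  obtain ⟨y, hy⟩ := Triangle.coyoneda_exact₃ _ hD (X := T) x (hX _)
  exact ⟨y, hy.symm⟩

lemma addClosure.hom_shift_eq_zero {X Y Z : C} (h : addClosure X Y)
    (hX : ∀ f : Z ⟶ X⟦(1 : ℤ)⟧, f = 0) (f : Z ⟶ Y⟦(1 : ℤ)⟧) : f = 0 :=
  (h.map (shiftFunctor C (1 : ℤ))).hom_to_eq_zero hX f

lemma IsClusterTilting.rigid_of_addClosure {T X Y : C} (hT : IsClusterTilting T)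
    (hX : addClosure T X) (hY : addClosure T Y) (f : X ⟶ Y⟦(1 : ℤ)⟧) : f = 0 :=
  hY.hom_shift_eq_zero (hX.hom_eq_zero hT.rigid) f

section FiniteDimensional

variable {k : Type w} [Field k] [Linear k C] [∀ X Y : C, Module.Finite k (X ⟶ Y)]

/-- Every object is the cone of a morphism in `add T`. -/
lemma IsClusterTilting.exists_triangle {T : C} (hT : IsClusterTilting T)
    (hCY : IsTwoCalabiYau k C) (X : C) :
    ∃ (T₁ T₀ : C) (t : T₁ ⟶ T₀) (p : T₀ ⟶ X) (q : X ⟶ T₁⟦(1 : ℤ)⟧),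
      Triangle.mk t p q ∈ distTriang C ∧ addClosure T T₁ ∧ addClosure T T₀ := by
  obtain ⟨n, p, hp⟩ := exists_approximation k T X
  obtain ⟨T₁, t, q, hD⟩ := distinguished_cocone_triangle₁ p
  -- By 2-Calabi-Yau symmetry it suffices that `Hom(T, ST₁) = 0`. A map `T ⟶ ST₁` dies in `ST₀`, so
  -- it comes from `T ⟶ X`; that map factors through `p`, which `q` kills.
  refine ⟨T₁, _, t, p, q, hD, hT.maximal _ (hCY.hom_shift_symm fun f => ?_),
    addClosure_biproduct T n⟩
  obtain ⟨g, hg⟩ := Triangle.coyoneda_exact₁ _ hD f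
    (hT.rigid_of_addClosure (addClosure_self T) (addClosure_biproduct T n) _)
  obtain ⟨g', rfl⟩ := hp g
  rw [hg]
  change (g' ≫ p) ≫ q = 0
  rw [Category.assoc, show p ≫ q = 0 from comp_distTriang_mor_zero₂₃ _ hD, comp_zero]

/-- As `T₀` is in `add T`, `f` vanishes on it and factors through `X ⟶ ST₁`. This is faithfulness
modulo `add ST`. -/
lemma IsClusterTilting.exists_factor {T : C} (hT : IsClusterTilting T)
    (hCY : IsTwoCalabiYau k C) {X Y : C} (f : X ⟶ Y) (hf : ∀ x : T ⟶ X, x ≫ f = 0) :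
    ∃ (Z : C) (a : X ⟶ Z) (b : Z ⟶ Y), addClosure (T⟦(1 : ℤ)⟧) Z ∧ f = a ≫ b := by
  obtain ⟨T₁, T₀, t, p, q, hD, h₁, h₀⟩ := hT.exists_triangle hCY X
  obtain ⟨g, hg⟩ := Triangle.yoneda_exact₃ _ hD f (h₀.comp_eq_zero f hf p)
  exact ⟨_, q, g, h₁.map (shiftFunctor C (1 : ℤ)), hg⟩

/-- The composite `FT₀ ⟶ FX ⟶ FY` lifts to a morphism that kills `t` by faithfulness on `add T`,
hence factors through `X`. -/
lemma IsClusterTilting.exists_coyoneda_map_eq {T : C} (hT : IsClusterTilting T)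
    (hCY : IsTwoCalabiYau k C) {X Y : C}
    (φ : (preadditiveCoyonedaObj T).obj X ⟶ (preadditiveCoyonedaObj T).obj Y) :
    ∃ f : X ⟶ Y, (preadditiveCoyonedaObj T).map f = φ := by
  obtain ⟨T₁, T₀, t, p, q, hD, h₁, h₀⟩ := hT.exists_triangle hCY X
  have htp : t ≫ p = 0 := comp_distTriang_mor_zero₁₂ _ hD
  obtain ⟨g, hg⟩ := h₀.exists_coyoneda_map_eq ((preadditiveCoyonedaObj T).map p ≫ φ)
  obtain ⟨f, hf⟩ : ∃ f : X ⟶ Y, g = p ≫ f := Triangle.yoneda_exact₂ _ hD g (h₁.eq_zero_of_coyoneda_map (by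
    change (preadditiveCoyonedaObj T).map (t ≫ g) = 0
    rw [Functor.map_comp, hg, ← Category.assoc, ← Functor.map_comp, htp, Functor.map_zero,
      zero_comp]))
  have := epi_coyoneda_map (T := T) hD (hT.rigid_of_addClosure (addClosure_self T) h₁)
  exact ⟨f, by rw [← cancel_epi ((preadditiveCoyonedaObj T).map p), ← hg, hf, Functor.map_comp]⟩

/-- Every finite-dimensional module is of the form `Hom(T, X)`. -/
lemma IsClusterTilting.exists_coyoneda_iso {T : C} (hT : IsClusterTilting T)
    {M : ModuleCat.{v} (End T)ᵐᵒᵖ} (hM : isFinDim k (End T)ᵐᵒᵖ M) :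
    ∃ X : C, Nonempty ((preadditiveCoyonedaObj T).obj X ≅ M) := by
  let := ModuleCat.moduleOfAlgebraModule (k := k) M
  have := ModuleCat.isScalarTower_of_algebra_moduleCat (k := k) M
  have : Module.Finite k M := hM
  have : Module.Finite (End T)ᵐᵒᵖ M := Module.Finite.of_restrictScalars_finite k _ M
  obtain ⟨n, m, hm⟩ := Module.Finite.exists_fin (R := (End T)ᵐᵒᵖ) (M := M)
  let B := ⨁ fun _ : Fin n => T
  let ψ : (preadditiveCoyonedaObj T).obj B ⟶ M :=
    coyonedaDesc (fun j => biproduct.π (fun _ : Fin n => T) j) m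
  have hψ : Epi ψ := by
    rw [ModuleCat.epi_iff_surjective]
    intro x
    obtain ⟨c, hc⟩ := (Submodule.mem_span_range_iff_exists_fun _).1
      (hm ▸ Submodule.mem_top (x := x))
    refine ⟨biproduct.lift (fun j => (c j).unop), ?_⟩
    rw [← hc]
    change ∑ j, (MulOpposite.op (End.of (biproduct.lift (fun j => (c j).unop) ≫
      biproduct.π (fun _ : Fin n => T) j))) • m j = _
    refine Finset.sum_congr rfl fun j _ => ?_
    congr 1
    exact congrArg MulOpposite.op (biproduct.lift_π _ _)
  let K := LinearMap.ker ψ.hom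
  have : K.FG := by
    let := ModuleCat.moduleOfAlgebraModule (k := k) ((preadditiveCoyonedaObj T).obj B)
    have := ModuleCat.isScalarTower_of_algebra_moduleCat (k := k)
      ((preadditiveCoyonedaObj T).obj B)
    have : Module.Finite k ((preadditiveCoyonedaObj T).obj B) := isFinDim_hom k T B
    have : IsNoetherian (End T)ᵐᵒᵖ ((preadditiveCoyonedaObj T).obj B) :=
      isNoetherian_of_tower k inferInstance
    exact IsNoetherian.noetherian K
  obtain ⟨l, s, hs⟩ := Submodule.fg_iff_exists_fin_generating_family.1 this
  -- Generators of the kernel are morphisms `T ⟶ B`; together they form `t`, whose cone has the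
  -- cokernel `M` as its image under `Hom(T, -)`.
  let y : Fin l → (T ⟶ B) := s
  let t : (⨁ fun _ : Fin l => T) ⟶ B := biproduct.desc y
  obtain ⟨X, p, q, hD⟩ := distinguished_cocone_triangle t
  have hzero : (preadditiveCoyonedaObj T).map t ≫ ψ = 0 := by
    refine coyoneda_hom_ext fun x => ?_
    change ψ.hom (x ≫ t : T ⟶ B) = 0
    have hx : (x ≫ t : T ⟶ B) =
        ∑ j, (MulOpposite.op (End.of (x ≫ biproduct.π (fun _ : Fin l => T) j))) • s j := by
      change x ≫ t = ∑ j, (x ≫ biproduct.π (fun _ : Fin l => T) j) ≫ y j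
      conv_lhs => rw [← Category.comp_id x, ← biproduct.total]
      simp only [t, Preadditive.comp_sum, Preadditive.sum_comp, Category.assoc,
        biproduct.ι_desc]
    rw [hx, map_sum]
    refine Finset.sum_eq_zero fun j _ => ?_
    have : s j ∈ K := hs ▸ Submodule.subset_span ⟨j, rfl⟩
    rw [map_smul, LinearMap.mem_ker.1 this, smul_zero]
  have hex : (ShortComplex.mk ((preadditiveCoyonedaObj T).map t) ψ hzero).Exact := by
    rw [ShortComplex.moduleCat_exact_iff]
    intro x hx
    have hx' : x ∈ Submodule.span (End T)ᵐᵒᵖ (Set.range s) := hs ▸ hx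
    obtain ⟨c, hc⟩ := (Submodule.mem_span_range_iff_exists_fun _).1 hx'
    refine ⟨biproduct.lift (fun j => (c j).unop), ?_⟩
    rw [← hc]
    change biproduct.lift (fun j => (c j).unop) ≫ biproduct.desc y = ∑ j, (c j).unop ≫ y j
    exact biproduct.lift_desc
  have := epi_coyoneda_map (T := T) hD
    (hT.rigid_of_addClosure (addClosure_self T) (addClosure_biproduct T l))
  exact ⟨X, nonempty_iso_of_exact (coyoneda_exact T hD) hex (Iso.refl _) (Iso.refl _)
    ((Category.id_comp _).trans (Category.comp_id _).symm)⟩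

/-- A rigid object `P` is cluster-tilting if `T` has a coresolution by `add P`. -/
lemma IsClusterTilting.of_triangle (hT : IsClusterTilting T) (hCY : IsTwoCalabiYau k C)
    {P P₀ Y : C} (hP : ∀ f : P ⟶ P⟦(1 : ℤ)⟧, f = 0) {a : T ⟶ P₀} {b : P₀ ⟶ Y}
    {c : Y ⟶ T⟦(1 : ℤ)⟧} (hD : Triangle.mk a b c ∈ distTriang C) (hP₀ : addClosure P P₀)
    (hY : addClosure P Y) : IsClusterTilting P := by
  refine ⟨hP, fun X hX => ?_⟩
  obtain ⟨n, p, hp⟩ := exists_approximation k P X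
  obtain ⟨W, s, d, hW⟩ := distinguished_cocone_triangle₁ p
  have hpd : p ≫ d = 0 := comp_distTriang_mor_zero₂₃ _ hW
  have hPX := hCY.hom_shift_symm hX
  have hPW : ∀ f : P ⟶ W⟦(1 : ℤ)⟧, f = 0 := fun f => by
    obtain ⟨g, hg⟩ : ∃ g : P ⟶ X, f = g ≫ d := Triangle.coyoneda_exact₁ _ hW f
      ((addClosure_biproduct P n).hom_shift_eq_zero hP _)
    obtain ⟨g', rfl⟩ := hp g
    rw [hg, Category.assoc, hpd, comp_zero]
  -- The obstruction to extending along `a` lies in `Hom(Y, SV)`, which vanishes because `Y` is in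
  -- `add P`.
  have hfac : ∀ (V : C), (∀ f : P ⟶ V⟦(1 : ℤ)⟧, f = 0) → ∀ g : T ⟶ V, ∃ g' : P₀ ⟶ V,
      g = a ≫ g' := fun V hV g => by
    obtain ⟨g', hg'⟩ : ∃ g' : P₀⟦(1 : ℤ)⟧ ⟶ V⟦(1 : ℤ)⟧, g⟦1⟧' = (-a⟦1⟧') ≫ g' :=
      Triangle.yoneda_exact₃ _ (rot_of_distTriang _ hD) (g⟦1⟧') (hY.hom_eq_zero hV _)
    obtain ⟨g'', rfl⟩ := (shiftFunctor C (1 : ℤ)).map_surjective g'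
    refine ⟨-g'', (shiftFunctor C (1 : ℤ)).map_injective ?_⟩
    rw [hg', Functor.map_comp, Functor.map_neg]
    simp
  have hTd : ∀ g : T ⟶ X, g ≫ d = 0 := fun g => by
    obtain ⟨g', rfl⟩ := hfac X hPX g
    rw [Category.assoc, hP₀.hom_eq_zero hPW (g' ≫ d), comp_zero]
  obtain ⟨T₁, T₀, t, p', q, hX', h₁, h₀⟩ := hT.exists_triangle hCY X
  obtain ⟨m', hm'⟩ : ∃ m' : T₁⟦(1 : ℤ)⟧ ⟶ W⟦(1 : ℤ)⟧, d = q ≫ m' :=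
    Triangle.yoneda_exact₃ _ hX' d (h₀.comp_eq_zero d hTd p')
  obtain ⟨m, rfl⟩ := (shiftFunctor C (1 : ℤ)).map_surjective m'
  -- Extending maps `T ⟶ W` to `P₀` makes each summand of `d` pass through a morphism `X ⟶ SP₀`,
  -- which is zero. Then `p` is a split epimorphism.
  have hd : d = 0 := by
    obtain ⟨l, u, v, huv⟩ := h₁.exists_sum
    rw [hm', ← Category.id_comp m, ← huv, Preadditive.sum_comp, Functor.map_sum,
      Preadditive.comp_sum]
    refine Finset.sum_eq_zero fun j _ => ?_
    obtain ⟨g, hg⟩ := hfac W hPW (v j ≫ m)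
    rw [Category.assoc, hg, ← Category.assoc, Functor.map_comp, ← Category.assoc,
      hP₀.hom_shift_eq_zero hX (q ≫ (u j ≫ a)⟦1⟧'), zero_comp]
  obtain ⟨i, hi⟩ : ∃ i : X ⟶ ⨁ fun _ : Fin n => P, 𝟙 X = i ≫ p :=
    Triangle.coyoneda_exact₃ _ hW (𝟙 X) (by
      change 𝟙 X ≫ d = 0
      rw [hd, comp_zero])
  exact ⟨n, ⟨⟨i, p, hi.symm⟩⟩⟩

end FiniteDimensional

end Triangulated

/-! ### Lifting modules, rigidity and coresolutions from `mod Γ` to `C`. -/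

section Lifting

variable {k : Type w} [Field k]
  {C : Type u} [Category.{v} C] [Preadditive C] [Linear k C] [HasZeroObject C] [HasShift C ℤ]
  [∀ n : ℤ, (shiftFunctor C n).Additive] [Pretriangulated C] [IsIdempotentComplete C]
  [∀ X Y : C, Module.Finite k (X ⟶ Y)] {T : C}

/-- The difference `𝟙 P - x` factors through `add ST`, so Fitting's lemma applies. -/
lemma IsClusterTilting.isIso_of_coyoneda_map_eq_id (hT : IsClusterTilting T)
    (hCY : IsTwoCalabiYau k C) {P : C} (hP : HasNoSummandIn (T⟦(1 : ℤ)⟧) P) (x : P ⟶ P)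
    (hx : (preadditiveCoyonedaObj T).map x = 𝟙 _) : IsIso x := by
  rw [← CategoryTheory.Functor.map_id, coyoneda_map_eq_iff] at hx
  obtain ⟨Z, a, b, hZ, hab⟩ := hT.exists_factor hCY (𝟙 P - x)
    fun g => by rw [Preadditive.comp_sub, hx, sub_self]
  exact hP.isIso_of_factor k hZ x a b hab

/-- Retracts of modules `Hom(T, Q)` lift, as long as summands in `add ST` are avoided. -/
lemma IsClusterTilting.nonempty_retract (hT : IsClusterTilting T) (hCY : IsTwoCalabiYau k C)
    {P Q : C} (hP : HasNoSummandIn (T⟦(1 : ℤ)⟧) P)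
    (ρ : Retract ((preadditiveCoyonedaObj T).obj P) ((preadditiveCoyonedaObj T).obj Q)) :
    Nonempty (Retract P Q) := by
  obtain ⟨f, hf⟩ := hT.exists_coyoneda_map_eq hCY ρ.i
  obtain ⟨g, hg⟩ := hT.exists_coyoneda_map_eq hCY ρ.r
  have := hT.isIso_of_coyoneda_map_eq_id hCY hP (f ≫ g) (by
    rw [Functor.map_comp, hf, hg, ρ.retract])
  exact ⟨⟨f, g ≫ inv (f ≫ g), by rw [← Category.assoc, IsIso.hom_inv_id]⟩⟩

lemma IsClusterTilting.nonempty_iso (hT : IsClusterTilting T) (hCY : IsTwoCalabiYau k C)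
    {P Q : C} (hP : HasNoSummandIn (T⟦(1 : ℤ)⟧) P) (hQ : HasNoSummandIn (T⟦(1 : ℤ)⟧) Q)
    (ε : (preadditiveCoyonedaObj T).obj P ≅ (preadditiveCoyonedaObj T).obj Q) :
    Nonempty (P ≅ Q) := by
  obtain ⟨f, hf⟩ := hT.exists_coyoneda_map_eq hCY ε.hom
  obtain ⟨g, hg⟩ := hT.exists_coyoneda_map_eq hCY ε.inv
  have := hT.isIso_of_coyoneda_map_eq_id hCY hP (f ≫ g) (by
    rw [Functor.map_comp, hf, hg, ε.hom_inv_id])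
  have := hT.isIso_of_coyoneda_map_eq_id hCY hQ (g ≫ f) (by
    rw [Functor.map_comp, hf, hg, ε.inv_hom_id])
  have : IsSplitMono f := ⟨⟨⟨g ≫ inv (f ≫ g), by rw [← Category.assoc, IsIso.hom_inv_id]⟩⟩⟩
  have : Epi f := epi_of_epi g f
  have := isIso_of_epi_of_isSplitMono f
  exact ⟨asIso f⟩

/-- Every finite-dimensional module lifts to an object without summands in `add ST`. -/
lemma IsClusterTilting.exists_hasNoSummandIn_coyoneda_iso (hT : IsClusterTilting T)
    {M : ModuleCat.{v} (End T)ᵐᵒᵖ} (hM : isFinDim k (End T)ᵐᵒᵖ M) :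
    ∃ P : C, HasNoSummandIn (T⟦(1 : ℤ)⟧) P ∧
      Nonempty ((preadditiveCoyonedaObj T).obj P ≅ M) := by
  obtain ⟨X, ⟨ε⟩⟩ := hT.exists_coyoneda_iso (k := k) hM
  obtain ⟨P, ρ, hP, hρ⟩ := exists_hasNoSummandIn_retract k hT.rigid X
  refine ⟨P, hP, ⟨⟨(preadditiveCoyonedaObj T).map ρ.i, (preadditiveCoyonedaObj T).map ρ.r, ?_, ?_⟩
    ≪≫ ε⟩⟩
  · rw [← Functor.map_comp, ρ.retract, CategoryTheory.Functor.map_id]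
  · rw [← Functor.map_comp, ← CategoryTheory.Functor.map_id, coyoneda_map_eq_iff]
    simpa using hρ

/-- The first term of a presentation of `P` yields a monomorphism if `Hom(T, P)` has projective
dimension at most one. -/
lemma IsClusterTilting.mono_coyoneda_map (hT : IsClusterTilting T) {P T₁ T₀ : C}
    (hP : HasNoSummandIn (T⟦(1 : ℤ)⟧) P) {t : T₁ ⟶ T₀} {p : T₀ ⟶ P} {q : P ⟶ T₁⟦(1 : ℤ)⟧}
    (hD : Triangle.mk t p q ∈ distTriang C) (h₁ : addClosure T T₁) (h₀ : addClosure T T₀)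
    (hpd : HasProjectiveDimensionLE ((preadditiveCoyonedaObj T).obj P) 1) :
    Mono ((preadditiveCoyonedaObj T).map t) := by
  let F := preadditiveCoyonedaObj T
  have hepi : Epi (F.map p) :=
    epi_coyoneda_map hD (hT.rigid_of_addClosure (addClosure_self T) h₁)
  have hex := coyoneda_exact T hD
  let S : ShortComplex (ModuleCat.{v} (End T)ᵐᵒᵖ) :=
    ShortComplex.mk (kernel.ι (F.map p)) (F.map p) (kernel.condition _)
  have hS : S.ShortExact := { exact := ShortComplex.exact_kernel _ }
  have := h₀.projective_coyoneda
  -- The first syzygy is projective, so `FT₁` splits over it; the complementary idempotent lifts to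
  -- `e` with `e ≫ t = 0`.
  have hK : Projective S.X₁ := projective_iff_hasProjectiveDimensionLT_one.2
    (hS.hasProjectiveDimensionLT_X₁ 1 (inferInstanceAs (HasProjectiveDimensionLT (F.obj T₀) 1))
      hpd)
  let σ : F.obj T₁ ⟶ S.X₁ := kernel.lift (F.map p) (F.map t) (by
    rw [← F.map_comp, show t ≫ p = 0 from comp_distTriang_mor_zero₁₂ _ hD, F.map_zero])
  have hσι : σ ≫ kernel.ι (F.map p) = F.map t := kernel.lift_ι _ _ _
  have hσ : Epi σ := hex.epi_kernelLift
  let s := Projective.factorThru (𝟙 S.X₁) σ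
  have hs : s ≫ σ = 𝟙 _ := Projective.factorThru_comp _ _
  obtain ⟨e, he⟩ := h₁.exists_coyoneda_map_eq (𝟙 _ - σ ≫ s)
  have hidem : (𝟙 (F.obj T₁) - σ ≫ s) ≫ (𝟙 (F.obj T₁) - σ ≫ s) = 𝟙 (F.obj T₁) - σ ≫ s := by
    simp [Preadditive.sub_comp, Preadditive.comp_sub, reassoc_of% hs]
  have hee : e ≫ e = e := sub_eq_zero.1 (h₁.eq_zero_of_coyoneda_map (by
    rw [Functor.map_sub, Functor.map_comp, he]
    exact sub_eq_zero.2 hidem))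
  have het : e ≫ t = 0 := h₁.eq_zero_of_coyoneda_map (by
    rw [Functor.map_comp, he]
    change (𝟙 (F.obj T₁) - σ ≫ s) ≫ F.map t = 0
    rw [← hσι]
    simp [Preadditive.sub_comp, reassoc_of% hs])
  obtain ⟨E, i, r, hir, hri⟩ := IsIdempotentComplete.idempotents_split T₁ e hee
  have hit : i ≫ t = 0 := by
    rw [← Category.id_comp i, ← hir, Category.assoc, Category.assoc, ← Category.assoc r, hri, het,
      comp_zero]
  -- The image `E` of `e` is killed by `t`, so `SE` becomes a summand of `P` in `add ST` and must
  -- vanish.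
  obtain ⟨z, hz⟩ : ∃ z : E⟦(1 : ℤ)⟧ ⟶ P, i⟦1⟧' = z ≫ q :=
    Triangle.coyoneda_exact₁ _ hD (i⟦(1 : ℤ)⟧') (by
      change i⟦(1 : ℤ)⟧' ≫ t⟦(1 : ℤ)⟧' = 0
      rw [← Functor.map_comp, hit, Functor.map_zero])
  have hE : IsZero (E⟦(1 : ℤ)⟧) := hP _ ⟨⟨z, q ≫ r⟦1⟧', by
      rw [← Category.assoc, ← hz, ← Functor.map_comp, hir, CategoryTheory.Functor.map_id]⟩⟩
    ((h₁.of_retract ⟨i, r, hir⟩).map (shiftFunctor C (1 : ℤ)))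
  have he0 : e = 0 := (shiftFunctor C (1 : ℤ)).map_injective (by
    rw [← hri, Functor.map_comp, hE.eq_of_src (i⟦(1 : ℤ)⟧') 0, comp_zero, Functor.map_zero])
  have hσs : σ ≫ s = 𝟙 _ := by
    rw [he0, Functor.map_zero] at he
    exact (sub_eq_zero.1 he.symm).symm
  have : IsSplitMono σ := ⟨⟨⟨s, hσs⟩⟩⟩
  change Mono (F.map t)
  rw [← hσι]
  infer_instance

/-- The lift of a module `M` with `pd M ≤ 1` and `Ext¹(M, M) = 0` is rigid. -/
lemma IsClusterTilting.rigid_lift (hT : IsClusterTilting T) (hCY : IsTwoCalabiYau k C) {P : C}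
    (hP : HasNoSummandIn (T⟦(1 : ℤ)⟧) P) {M : ModuleCat.{v} (End T)ᵐᵒᵖ}
    (ε : (preadditiveCoyonedaObj T).obj P ≅ M) (hpd : HasProjectiveDimensionLE M 1)
    (hext : ∀ e : Abelian.Ext.{v} M M 1, e = 0) (f : P ⟶ P⟦(1 : ℤ)⟧) : f = 0 := by
  let F := preadditiveCoyonedaObj T
  obtain ⟨T₁, T₀, t, p, q, hD, h₁, h₀⟩ := hT.exists_triangle hCY P
  have hmono : Mono (F.map t) := hT.mono_coyoneda_map hP hD h₁ h₀
    (hasProjectiveDimensionLT_of_iso ε.symm 2)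
  have hepi : Epi (F.map p) :=
    epi_coyoneda_map hD (hT.rigid_of_addClosure (addClosure_self T) h₁)
  let S : ShortComplex (ModuleCat.{v} (End T)ᵐᵒᵖ) := ShortComplex.mk (F.map t)
    (F.map p ≫ ε.hom) (by
      rw [← Category.assoc, ← F.map_comp, show t ≫ p = 0 from comp_distTriang_mor_zero₁₂ _ hD,
        F.map_zero, zero_comp])
  let e : ShortComplex.mk (F.map t) (F.map p) (by
      rw [← F.map_comp, show t ≫ p = 0 from comp_distTriang_mor_zero₁₂ _ hD, F.map_zero]) ≅ S :=
    ShortComplex.isoMk (Iso.refl _) (Iso.refl _) ε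
      ((Category.id_comp _).trans (Category.comp_id _).symm) (Category.id_comp _)
  have hS : S.ShortExact :=
    { exact := ShortComplex.exact_of_iso e (coyoneda_exact T hD)
      mono_f := hmono
      epi_g := epi_comp _ _ }
  -- If `p ≫ f = 0`, then `f = q ≫ Sh` with `h : T₁ ⟶ P`. Extending `h` along `t` gives `f = 0`,
  -- because `q ≫ St = 0`.
  refine hCY.hom_shift_eq_zero_of_precomp p (hT.rigid_of_addClosure h₀ h₀) (fun f hf => ?_) f
  obtain ⟨h', hh'⟩ : ∃ h' : T₁⟦(1 : ℤ)⟧ ⟶ P⟦(1 : ℤ)⟧, f = q ≫ h' :=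
    Triangle.yoneda_exact₃ _ hD f hf
  obtain ⟨h, rfl⟩ := (shiftFunctor C (1 : ℤ)).map_surjective h'
  obtain ⟨g, hg⟩ := exists_extension_of_ext_eq_zero hS hext (F.map h ≫ ε.hom)
  obtain ⟨g', hg'⟩ := h₀.exists_coyoneda_map_eq (g ≫ ε.inv)
  have hth : t ≫ g' = h := sub_eq_zero.1 (h₁.eq_zero_of_coyoneda_map (by
    rw [Functor.map_sub, Functor.map_comp, hg', ← Category.assoc]
    change (S.f ≫ g) ≫ ε.inv - F.map h = 0
    rw [hg]
    simp))
  rw [hh', ← hth, Functor.map_comp, ← Category.assoc,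
    show q ≫ t⟦(1 : ℤ)⟧' = 0 from comp_distTriang_mor_zero₃₁ _ hD, zero_comp]

lemma IsClusterTilting.addClosure_of_coyoneda (hT : IsClusterTilting T)
    (hCY : IsTwoCalabiYau k C) {P Q : C} (hQ : HasNoSummandIn (T⟦(1 : ℤ)⟧) Q)
    (h : addClosure ((preadditiveCoyonedaObj T).obj P) ((preadditiveCoyonedaObj T).obj Q)) :
    addClosure P Q := by
  obtain ⟨n, ⟨ρ⟩⟩ := exists_retract_coyoneda_biproduct h
  obtain ⟨σ⟩ := hT.nonempty_retract hCY hQ ρ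
  exact ⟨n, ⟨σ⟩⟩

/-- The coresolution of the regular module by a tilting module lifts to a triangle. -/
lemma IsClusterTilting.exists_triangle_of_coresolution (hT : IsClusterTilting T)
    (hCY : IsTwoCalabiYau k C) {P : C} {S : ShortComplex (ModuleCat.{v} (End T)ᵐᵒᵖ)}
    (hS : S.ShortExact) (θ : S.X₁ ≅ ModuleCat.of _ (End T)ᵐᵒᵖ)
    (h₂ : addClosure ((preadditiveCoyonedaObj T).obj P) S.X₂)
    (h₃ : addClosure ((preadditiveCoyonedaObj T).obj P) S.X₃) :
    ∃ (P₀ Y : C) (a : T ⟶ P₀) (b : P₀ ⟶ Y) (c : Y ⟶ T⟦(1 : ℤ)⟧),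
      Triangle.mk a b c ∈ distTriang C ∧ addClosure P P₀ ∧ addClosure P Y := by
  let F := preadditiveCoyonedaObj T
  obtain ⟨n, ⟨ρ⟩⟩ := exists_retract_coyoneda_biproduct h₂
  obtain ⟨P₀, hP₀, ⟨ε⟩⟩ := hT.exists_hasNoSummandIn_coyoneda_iso
    (isFinDim_of_retract (isFinDim_hom k T _) ρ)
  have hP₀' : addClosure P P₀ :=
    hT.addClosure_of_coyoneda hCY hP₀ (h₂.of_retract ε.retract)
  obtain ⟨a, ha⟩ := (addClosure_self T).exists_coyoneda_map_eq
    ((coyonedaSelfIso T ≪≫ θ.symm).hom ≫ S.f ≫ ε.inv)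
  have := hS.mono_f
  have := hS.epi_g
  have hmono : Mono (F.map a) := by
    change Mono ((preadditiveCoyonedaObj T).map a)
    rw [ha]
    infer_instance
  obtain ⟨Y, b, c, hD⟩ := distinguished_cocone_triangle a
  refine ⟨P₀, Y, a, b, c, hD, hP₀', ?_⟩
  have hepi : Epi (F.map b) := epi_coyoneda_map hD hT.rigid
  have hcomm : (coyonedaSelfIso T ≪≫ θ.symm).hom ≫ S.f =
      (preadditiveCoyonedaObj T).map a ≫ ε.hom := by
    rw [ha]
    simp
  obtain ⟨e⟩ := nonempty_iso_of_exact (coyoneda_exact T hD) hS.exact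
    (coyonedaSelfIso T ≪≫ θ.symm) ε hcomm
  -- The cone `Y` may have summands in `add ST`, invisible to `F`; only `Y'` is controlled by the
  -- module `S.X₃`.
  obtain ⟨Y', ρ', hY', hρ'⟩ := exists_hasNoSummandIn_retract k hT.rigid Y
  have hY'P : addClosure P Y' := hT.addClosure_of_coyoneda hCY hY'
    (h₃.of_retract ((ρ'.map F).trans (Iso.retract e)))
  obtain ⟨Z, x, y, hZ, hxy⟩ := hT.exists_factor hCY (𝟙 Y - ρ'.r ≫ ρ'.i)
    fun g => by rw [Preadditive.comp_sub, hρ', Category.comp_id, sub_self]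
  -- A map `ST ⟶ Y ⟶ ST` is `Sd` with `d ≫ a = 0`, so `d = 0` because `Fa` is mono. Hence `y`
  -- factors through `P₀`, and the remainder of `𝟙 Y` passes through `add P` as well.
  have hyc : y ≫ c = 0 := hZ.comp_eq_zero c (fun z => by
    obtain ⟨d, hd⟩ := (shiftFunctor C (1 : ℤ)).map_surjective (z ≫ c)
    have hda : d ≫ a = 0 := (shiftFunctor C (1 : ℤ)).map_injective (by
      rw [Functor.map_comp, hd, Category.assoc,
        show c ≫ a⟦(1 : ℤ)⟧' = 0 from comp_distTriang_mor_zero₃₁ _ hD, comp_zero,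
        Functor.map_zero])
    have hd0 : F.map d = 0 := by
      rw [← cancel_mono (F.map a), ← F.map_comp, hda, F.map_zero, zero_comp]
    rw [← hd, (addClosure_self T).eq_zero_of_coyoneda_map hd0, Functor.map_zero]) y
  obtain ⟨y', hy'⟩ : ∃ y' : Z ⟶ P₀, y = y' ≫ b := Triangle.coyoneda_exact₃ _ hD y hyc
  refine hY'P.of_id_eq_add hP₀' ρ'.r ρ'.i (x ≫ y') b ?_
  rw [Category.assoc, ← hy', ← hxy, add_sub_cancel]

end Lifting

end ClusterTilting

/-! ### The equivalence and the lifting of tilting modules, assembled. -/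

theorem theorem3p3
    {k : Type w} [Field k] [IsAlgClosed k]
    {C : Type u} [Category.{v} C] [Preadditive C] [Linear k C] [HasZeroObject C]
    [HasShift C ℤ] [∀ n : ℤ, (shiftFunctor C n).Additive]
    [∀ n : ℤ, (shiftFunctor C n).Linear k]
    [Pretriangulated C] [IsTriangulated C] [IsIdempotentComplete C]
    [∀ X Y : C, Module.Finite k (X ⟶ Y)]
    (hKS : ClusterTilting.IsKrullSchmidt C)
    (hCY : ClusterTilting.IsTwoCalabiYau k C)
    (T : C) (hT : ClusterTilting.IsClusterTilting T) :
    -- `F = Hom(T, -)` induces an equivalence `C / add ST ≌ mod Γ`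
    (∃ H : ∀ (X Y : C) (f g : X ⟶ Y), ClusterTilting.addRel (T⟦(1 : ℤ)⟧) f g →
        (ClusterTilting.homFunctor k T).map f = (ClusterTilting.homFunctor k T).map g,
      (CategoryTheory.Quotient.lift (ClusterTilting.addRel (T⟦(1 : ℤ)⟧))
        (ClusterTilting.homFunctor k T) H).IsEquivalence) ∧
    -- every tilting module lifts to a cluster-tilting object, namely to its preimage under `F`
    -- without direct factors in `add ST`, which is unique up to isomorphism
    ∀ L : ClusterTilting.FDMod k (End T)ᵐᵒᵖ, ClusterTilting.IsTiltingModule L →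
      ∃ P : C, Nonempty ((ClusterTilting.homFunctor k T).obj P ≅ L) ∧
        ClusterTilting.HasNoSummandIn (T⟦(1 : ℤ)⟧) P ∧
        ClusterTilting.IsClusterTilting P ∧
        ∀ Q : C, Nonempty ((ClusterTilting.homFunctor k T).obj Q ≅ L) →
          ClusterTilting.HasNoSummandIn (T⟦(1 : ℤ)⟧) Q → Nonempty (Q ≅ P) := by
  have map_eq_iff : ∀ {X Y : C} (f g : X ⟶ Y),
      (ClusterTilting.homFunctor k T).map f = (ClusterTilting.homFunctor k T).map g ↔
        (preadditiveCoyonedaObj T).map f = (preadditiveCoyonedaObj T).map g := fun f g =>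
    ⟨fun h => congrArg (fun φ => φ.hom) h, fun h => ObjectProperty.hom_ext _ h⟩
  refine ⟨⟨fun X Y f g ⟨Z, a, b, hZ, hab⟩ => ?_, ?_⟩, fun L hL => ?_⟩
  · rw [map_eq_iff, ClusterTilting.coyoneda_map_eq_iff]
    intro x
    rw [← sub_eq_zero, ← Preadditive.comp_sub, hab, ← Category.assoc,
      hZ.hom_to_eq_zero hT.rigid (x ≫ a), zero_comp]
  · refine @Functor.IsEquivalence.mk _ _ _ _ _ ⟨?_⟩ ⟨?_⟩ ⟨?_⟩
    · intro X Y f g hfg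
      obtain ⟨f, rfl⟩ := (Quotient.functor _).map_surjective f
      obtain ⟨g, rfl⟩ := (Quotient.functor _).map_surjective g
      refine CategoryTheory.Quotient.sound _ (hT.exists_factor hCY (f - g) fun x => ?_)
      have := (map_eq_iff f g).1 hfg
      rw [Preadditive.comp_sub, (ClusterTilting.coyoneda_map_eq_iff T f g).1 this, sub_self]
    · intro X Y φ
      obtain ⟨f, hf⟩ := hT.exists_coyoneda_map_eq hCY (X := X.as) (Y := Y.as) φ.hom
      exact ⟨(Quotient.functor _).map f, ObjectProperty.hom_ext _ hf⟩
    · intro M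
      obtain ⟨X, ⟨e⟩⟩ := hT.exists_coyoneda_iso M.property
      exact ⟨(Quotient.functor _).obj X, ⟨ObjectProperty.isoMk _ e⟩⟩
  · obtain ⟨P, hP, ⟨ε⟩⟩ := hT.exists_hasNoSummandIn_coyoneda_iso L.property
    obtain ⟨S, hS, ⟨θ⟩, h₂, h₃⟩ := hL.coresolution
    obtain ⟨P₀, Y, a, b, c, hD, hP₀, hY⟩ := hT.exists_triangle_of_coresolution hCY hS θ
      (h₂.of_iso_left ε.symm) (h₃.of_iso_left ε.symm)
    have hrig := hT.rigid_lift hCY hP ε hL.projDim_le_one hL.ext_one_eq_zero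
    refine ⟨P, ⟨ObjectProperty.isoMk _ ε⟩, hP, hT.of_triangle hCY hrig hD hP₀ hY, ?_⟩
    rintro Q ⟨η⟩ hQ
    exact hT.nonempty_iso hCY hQ hP ((ClusterTilting.isFinDim k (End T)ᵐᵒᵖ).ι.mapIso η ≪≫ ε.symm)
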